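/- **Corollary 3.1.** Let $\sigma>1$ be real and let $m\ge 0$ be an integer with $m<(\sigma-1)/2$. Let $\mathbb D=\{z\in\mathbb C:|z|<1\}$. For $k=0,1,2,\dots$ and $z\in\mathbb D$ put $$\Phi_k^{\sigma,m}(z)=\sqrt{\frac{(\sigma-2m-1)\,\Gamma(\sigma-m)\,k!}{\pi\,m!\,\Gamma(\sigma-2m+k)}}\;\frac{(-1)^k\,\bar z^{\,m-k}}{(1-z\bar z)^m}\;P_k^{(m-k,\,\sigma-2m-1)}(1-2z\bar z),$$ where, for real $\alpha,\beta$, $$P_k^{(\alpha,\beta)}(x)=\sum_{s=0}^{k}\binom{k+\alpha}{k-s}\binom{k+\beta}{s}\Big(\frac{x-1}{2}\Big)^{s}\Big(\frac{x+1}{2}\Big)^{k-s}$$ is the Jacobi polynomial (generalized binomial coefficients); for $z=0$ and $k>m$ the expression is extended by continuity, $\Phi_k^{\sigma,m}(0)=0$. Let $\mathcal H$ be a complex Hilbert space with an orthonormal sequence $(\psi_k)_{k\ge 0}$, and consider the coherent states $$|z,\sigma,m\rangle=\mathcal N_{\sigma,m}(z)^{-1/2}\sum_{k=0}^{\infty}\overline{\Phi_k^{\sigma,m}(z)}\;\psi_k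 ,\qquad z\in\mathbb D,$$ where the normalization factor $\mathcal N_{\sigma,m}(z)>0$ is determined by $\langle z,\sigma,m|z,\sigma,m\rangle=1$. Then for every $z\in\mathbb D$ the series defining $|z,\sigma,m\rangle$ converges in $\mathcal H$, and the normalization factor exists, is unique and is given by $$\mathcal N_{\sigma,m}(z)=\sum_{k=0}^{\infty}\big|\Phi_k^{\sigma,m}(z)\big|^2=\frac{\sigma-2m-1}{\pi\,(1-z\bar z)^{\sigma}} .$$ -/

import Mathlib

/-- The Jacobi polynomial `P_n^{(α, β)}` evaluated at `x`, for arbitrary real parameters: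
`∑_{s = 0}^{n} C(n + α, n - s) C(n + β, s) ((x - 1) / 2)^s ((x + 1) / 2)^(n - s)`,
with generalized binomial coefficients `C(a, s) = a (a - 1) ⋯ (a - s + 1) / s!`. -/
noncomputable def jacobiP (n : ℕ) (α β x : ℝ) : ℝ :=
  ∑ s ∈ Finset.range (n + 1),
    Ring.choose ((n : ℝ) + α) (n - s) * Ring.choose ((n : ℝ) + β) s *
      ((x - 1) / 2) ^ s * ((x + 1) / 2) ^ (n - s)

/-- The functions `Φ_k^{σ,m}` of the Landau-level basis on the unit disk.
At `z = 0` and `k > m` the written expression has a removable singularity, where its limit is `0`;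
this is also the value here, since `0 ^ (m - k) = 0` for the negative exponent `m - k`. -/
noncomputable def basisPhi (σ : ℝ) (m k : ℕ) (z : ℂ) : ℂ :=
  (Real.sqrt ((σ - 2 * m - 1) * Real.Gamma (σ - m) * (k.factorial : ℝ) /
      (Real.pi * (m.factorial : ℝ) * Real.Gamma (σ - 2 * m + k))) : ℂ) *
    ((-1) ^ k * (starRingEnd ℂ z) ^ ((m : ℤ) - (k : ℤ)) /
      (1 - z * starRingEnd ℂ z) ^ m) *
    (jacobiP k ((m : ℝ) - k) (σ - 2 * m - 1) (1 - 2 * ‖z‖ ^ 2) : ℂ)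

/-- The vector `N^{-1/2} ∑_k conj (Φ_k^{σ,m}(z)) ψ_k`: the coherent state with label `z`, built on
the states `ψ`, when `N` is the normalization factor. -/
noncomputable def coherentState {H : Type*} [NormedAddCommGroup H] [InnerProductSpace ℂ H]
    (ψ : ℕ → H) (σ : ℝ) (m : ℕ) (N : ℝ) (z : ℂ) : H :=
  ((N ^ (-(1 / 2) : ℝ) : ℝ) : ℂ) • ∑' k : ℕ, starRingEnd ℂ (basisPhi σ m k z) • ψ k

/-- `N` is a normalization factor at `z`: it is positive, the superposition converges in `H`, and
the state it defines has `⟨z, σ, m | z, σ, m⟩ = 1`. -/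
def IsNormalizationFactor {H : Type*} [NormedAddCommGroup H] [InnerProductSpace ℂ H]
    (ψ : ℕ → H) (σ : ℝ) (m : ℕ) (z : ℂ) (N : ℝ) : Prop :=
  0 < N ∧ Summable (fun k : ℕ => starRingEnd ℂ (basisPhi σ m k z) • ψ k) ∧
    inner ℂ (coherentState ψ σ m N z) (coherentState ψ σ m N z) = 1

/-! ### Norms of Möbius images of monomials in a weighted Hilbert space of power series. -/

section LadderOperators

open PowerSeries Filter Topology

/-! Put `a = σ - 2m`, `c = ‖z‖`. By `norm_basisPhi_sq`, `‖Φ_k‖ ^ 2` is a factor independent of `k`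
times the squared `k`-th Taylor coefficient of `e_m = (X - c)^m (1 - cX)^(-(a + m))`, weighted by `1
/ multichoose a k`, the squared norm of `X^k` in the weight `a` Bergman space. So the claim is
`‖e_m‖² = (1 - c²)^(-a) / multichoose a m` (`hasSum_sq_coeff_mobiusMonomial`). This goes by
induction on `m`. The case `m = 0` is the binomial series at `c²`. Raising and lowering operators
shift `m` by one and are mutually adjoint (`sum_raiseOp_sub_lowerOp`), whence `(a + m) ‖e_{m+1}‖² =
(m + 1) ‖e_m‖²`. -/

theorem succ_mul_multichoose_succ (a : ℝ) (k : ℕ) :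
    ((k : ℝ) + 1) * Ring.multichoose a (k + 1) = a * Ring.multichoose (a + 1) k := by
  have h1 := Ring.factorial_nsmul_multichoose_eq_ascPochhammer a (k + 1)
  have h2 := Ring.factorial_nsmul_multichoose_eq_ascPochhammer (a + 1) k
  rw [Polynomial.ascPochhammer_smeval_eq_eval] at h1 h2
  rw [ascPochhammer_succ_left, Polynomial.eval_mul, Polynomial.eval_comp, nsmul_eq_mul] at h1
  simp only [Polynomial.eval_X, Polynomial.eval_add, Polynomial.eval_one, nsmul_eq_mul] at h1 h2
  rw [← h2, Nat.factorial_succ] at h1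
  push_cast at h1
  have : (k.factorial : ℝ) ≠ 0 := by positivity
  apply mul_left_cancel₀ this
  linarith

theorem succ_mul_multichoose_succ' (a : ℝ) (k : ℕ) :
    ((k : ℝ) + 1) * Ring.multichoose a (k + 1) = (a + k) * Ring.multichoose a k := by
  induction k with
  | zero => simp
  | succ k ih =>
    have h1 := succ_mul_multichoose_succ a k
    have h2 := succ_mul_multichoose_succ a (k + 1)
    have h3 := Ring.multichoose_succ_succ a k
    push_cast at h2 ⊢
    rw [h2, h3]
    linarith

theorem multichoose_pos {a : ℝ} (ha : 0 < a) (k : ℕ) : 0 < Ring.multichoose a k := by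
  induction k with
  | zero => simp
  | succ k ih =>
    have h := succ_mul_multichoose_succ' a k
    have : 0 < (a + k) * Ring.multichoose a k := by positivity
    rw [← h] at this
    exact pos_of_mul_pos_right this (by positivity)

theorem Gamma_add_nat {a : ℝ} (ha : 0 < a) (k : ℕ) :
    Real.Gamma (a + k) = Ring.multichoose a k * k.factorial * Real.Gamma a := by
  induction k with
  | zero => simp
  | succ k ih =>
    have h := succ_mul_multichoose_succ' a k
    push_cast
    rw [← add_assoc, Real.Gamma_add_one (by positivity), ih, Nat.factorial_succ]
    push_cast
    linear_combination (-(k.factorial : ℝ) * Real.Gamma a) * h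

theorem hasSum_multichoose_mul_pow (a : ℝ) {x : ℝ} (hx : |x| < 1) :
    HasSum (fun k => Ring.multichoose a k * x ^ k) ((1 - x) ^ (-a)) := by
  have h := (Real.one_div_one_sub_rpow_hasFPowerSeriesOnBall_zero a).hasSum (y := x)
    (by simpa [enorm_eq_nnnorm, ← NNReal.coe_lt_coe] using hx)
  rw [zero_add, one_div, ← Real.rpow_neg (by linarith [le_abs_self x])] at h
  simpa [FormalMultilinearSeries.ofScalars, Ring.multichoose_eq, mul_comm] using h

/-- The power series of `(1 - c X) ^ (-a)`. -/
noncomputable def negBinomialSeries (c a : ℝ) : PowerSeries ℝ :=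
  PowerSeries.mk fun k => Ring.multichoose a k * c ^ k

theorem one_sub_mul_negBinomialSeries (c a : ℝ) :
    (1 - C c * X) * negBinomialSeries c (a + 1) = negBinomialSeries c a := by
  rw [sub_mul, one_mul, mul_assoc]
  ext k
  cases k with
  | zero => simp [negBinomialSeries]
  | succ k =>
    rw [map_sub, coeff_C_mul, coeff_succ_X_mul]
    simp only [negBinomialSeries, coeff_mk, Ring.multichoose_succ_succ]
    ring

theorem derivative_negBinomialSeries (c a : ℝ) :
    d⁄dX ℝ (negBinomialSeries c a) = C (c * a) * negBinomialSeries c (a + 1) := by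
  ext k
  rw [coeff_derivative, coeff_C_mul]
  simp only [negBinomialSeries, coeff_mk]
  linear_combination c ^ (k + 1) * succ_mul_multichoose_succ a k

/-- The power series of `(X - c) ^ m (1 - c X) ^ (-(a + m))`: up to a scalar factor, the image of
`X ^ m` under a disk automorphism in the weight `a` representation. -/
noncomputable def mobiusMonomial (c a : ℝ) (m : ℕ) : PowerSeries ℝ :=
  (X - C c) ^ m * negBinomialSeries c (a + m)

/-- The raising operator attached to the disk automorphism with parameter `c`. -/
noncomputable def raiseOp (c a : ℝ) (e : PowerSeries ℝ) : PowerSeries ℝ :=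
  (X - C c) ^ 2 * d⁄dX ℝ e + C a * (X - C c) * e

/-- The lowering operator attached to the disk automorphism with parameter `c`. -/
noncomputable def lowerOp (c a : ℝ) (e : PowerSeries ℝ) : PowerSeries ℝ :=
  (1 - C c * X) ^ 2 * d⁄dX ℝ e - C c * C a * (1 - C c * X) * e

theorem raiseOp_mobiusMonomial (c a : ℝ) (m : ℕ) :
    raiseOp c a (mobiusMonomial c a m) = C ((a + m) * (1 - c ^ 2)) * mobiusMonomial c a (m + 1) := by
  have h := one_sub_mul_negBinomialSeries c (a + m)
  have hd : (X - C c) ^ 2 * d⁄dX ℝ ((X - C c : PowerSeries ℝ) ^ m) =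
      C (m : ℝ) * (X - C c) ^ (m + 1) := by
    cases m with
    | zero => simp
    | succ n => simp; ring
  simp only [raiseOp, mobiusMonomial, Derivation.leibniz, derivative_negBinomialSeries, smul_eq_mul,
    Nat.cast_add, Nat.cast_one, ← add_assoc]
  rw [← h]
  simp only [map_mul, map_add, map_sub, map_pow, map_one] at hd ⊢
  linear_combination (1 - C c * X) * negBinomialSeries c (a + m + 1) * hd

theorem lowerOp_mobiusMonomial (c a : ℝ) (m : ℕ) :
    lowerOp c a (mobiusMonomial c a (m + 1)) =
      C ((m + 1) * (1 - c ^ 2)) * mobiusMonomial c a m := by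
  have h0 := one_sub_mul_negBinomialSeries c (a + m)
  have h1 := one_sub_mul_negBinomialSeries c (a + m + 1)
  have hd : d⁄dX ℝ ((X - C c : PowerSeries ℝ) ^ (m + 1)) =
      C ((m : ℝ) + 1) * (X - C c) ^ m := by
    simp
  simp only [lowerOp, mobiusMonomial, Derivation.leibniz, derivative_negBinomialSeries, smul_eq_mul,
    Nat.cast_add, Nat.cast_one, ← add_assoc, hd]
  rw [← h0, ← h1]
  simp only [map_mul, map_add, map_sub, map_pow, map_one]
  ring

theorem coeff_X_mul_derivative (e : PowerSeries ℝ) (k : ℕ) :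
    coeff k (X * d⁄dX ℝ e) = k * coeff k e := by
  cases k with
  | zero => simp
  | succ k => rw [coeff_succ_X_mul, coeff_derivative]; push_cast; ring

theorem raiseOp_eq (c a : ℝ) (e : PowerSeries ℝ) :
    raiseOp c a e = X * (X * d⁄dX ℝ e) - C (2 * c) * (X * d⁄dX ℝ e) + C (c ^ 2) * d⁄dX ℝ e +
      C a * (X * e) - C (a * c) * e := by
  simp only [raiseOp, map_mul, map_pow, map_ofNat]
  ring

theorem lowerOp_eq (c a : ℝ) (e : PowerSeries ℝ) :
    lowerOp c a e = d⁄dX ℝ e - C (2 * c) * (X * d⁄dX ℝ e) + C (c ^ 2) * (X * (X * d⁄dX ℝ e)) -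
      C (a * c) * e + C (a * c ^ 2) * (X * e) := by
  simp only [lowerOp, map_mul, map_pow, map_ofNat]
  ring

/-- Adjointness in truncated form: the differences telescope, leaving only a boundary term, so no
convergence is needed here. -/
theorem sum_raiseOp_sub_lowerOp {a : ℝ} (ha : 0 < a) (c : ℝ) (e f : PowerSeries ℝ) (K : ℕ) :
    ∑ k ∈ Finset.range (K + 1), (Ring.multichoose a k)⁻¹ *
        (coeff k (raiseOp c a e) * coeff k f - coeff k e * coeff k (lowerOp c a f)) =
      (K + 1) * (Ring.multichoose a K)⁻¹ *
        (c ^ 2 * coeff (K + 1) e * coeff K f - coeff K e * coeff (K + 1) f) := by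
  simp only [raiseOp_eq, lowerOp_eq]
  induction K with
  | zero =>
    have h (g : PowerSeries ℝ) : constantCoeff (d⁄dX ℝ g) = coeff 1 g := by
      rw [← coeff_zero_eq_constantCoeff_apply, coeff_derivative]
      simp
    simp [h]
    ring
  | succ K ih =>
    rw [Finset.sum_range_succ, ih]
    -- The weight recurrence puts the old boundary term on the weight of the new summand.
    have h : ((K : ℝ) + 1) * (Ring.multichoose a K)⁻¹ =
        (a + K) * (Ring.multichoose a (K + 1))⁻¹ := by
      have h1 := (multichoose_pos ha K).ne'
      have h2 := (multichoose_pos ha (K + 1)).ne'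
      field_simp
      linarith [succ_mul_multichoose_succ' a K]
    rw [h]
    simp only [map_add, map_sub, coeff_C_mul, coeff_succ_X_mul, coeff_X_mul_derivative,
      coeff_derivative]
    push_cast
    ring

/-- The factor `k` is absorbed by differentiation, which gives a series of the same kind with `a +
1`. -/
theorem tendsto_coeff_negBinomialSeries {c : ℝ} (hc : |c| < 1) (a : ℝ) :
    Tendsto (fun k : ℕ => coeff k (negBinomialSeries c a)) atTop (𝓝 0) ∧
      Tendsto (fun k : ℕ => (k : ℝ) * coeff k (negBinomialSeries c a)) atTop (𝓝 0) := by
  have h (b : ℝ) : Tendsto (fun k : ℕ => coeff k (negBinomialSeries c b)) atTop (𝓝 0) := by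
    simpa [negBinomialSeries] using (hasSum_multichoose_mul_pow b hc).summable.tendsto_atTop_zero
  refine ⟨h a, ?_⟩
  rw [← tendsto_add_atTop_iff_nat 1]
  have := (h (a + 1)).const_mul (c * a)
  rw [mul_zero] at this
  refine this.congr fun k => ?_
  rw [← coeff_C_mul, ← derivative_negBinomialSeries, coeff_derivative]
  push_cast
  ring

theorem tendsto_coeff_mobiusMonomial {c : ℝ} (hc : |c| < 1) (a : ℝ) (m : ℕ) :
    Tendsto (fun k : ℕ => coeff k (mobiusMonomial c a m)) atTop (𝓝 0) ∧
      Tendsto (fun k : ℕ => (k : ℝ) * coeff k (mobiusMonomial c a m)) atTop (𝓝 0) := by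
  induction m generalizing a with
  | zero => simpa [mobiusMonomial] using tendsto_coeff_negBinomialSeries hc a
  | succ m ih =>
    have h : mobiusMonomial c a (m + 1) =
        X * mobiusMonomial c (a + 1) m - C c * mobiusMonomial c (a + 1) m := by
      simp only [mobiusMonomial, Nat.cast_add, Nat.cast_one, add_right_comm a 1, ← add_assoc]
      ring
    obtain ⟨h0, h1⟩ := ih (a + 1)
    have h0' := h0.comp (tendsto_add_atTop_nat 1)
    have h1' := h1.comp (tendsto_add_atTop_nat 1)
    rw [h, ← tendsto_add_atTop_iff_nat 1,
      ← tendsto_add_atTop_iff_nat (f := fun k : ℕ => (k : ℝ) * _) 1]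
    constructor
    · simpa [coeff_succ_X_mul, Function.comp_def] using h0.sub (h0'.const_mul c)
    · have := (h1.add h0).sub (h1'.const_mul c)
      simp only [add_zero, mul_zero, sub_zero, Function.comp_def] at this
      refine this.congr fun k => ?_
      rw [map_sub, coeff_succ_X_mul, coeff_C_mul]
      push_cast
      ring

theorem hasSum_sq_coeff_mobiusMonomial {a : ℝ} (ha : 1 ≤ a) {c : ℝ} (hc : |c| < 1) (m : ℕ) :
    HasSum (fun k : ℕ => (Ring.multichoose a k)⁻¹ * coeff k (mobiusMonomial c a m) ^ 2)
      ((Ring.multichoose a m)⁻¹ * (1 - c ^ 2) ^ (-a)) := by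
  have ha' : 0 < a := by linarith
  have hc2 : c ^ 2 < 1 := (sq_lt_one_iff_abs_lt_one c).2 hc
  induction m with
  | zero =>
    have h := hasSum_multichoose_mul_pow a (x := c ^ 2) (by rwa [abs_of_nonneg (sq_nonneg c)])
    simp only [Ring.multichoose_zero_right, inv_one, one_mul]
    refine h.congr_fun fun k => ?_
    have := (multichoose_pos ha' k).ne'
    simp only [mobiusMonomial, negBinomialSeries, pow_zero, one_mul, Nat.cast_zero, add_zero,
      coeff_mk]
    field_simp
    ring
  | succ m ih =>
    set e := mobiusMonomial c a m with he
    set f := mobiusMonomial c a (m + 1) with hf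
    rw [hasSum_iff_tendsto_nat_of_nonneg
      (fun k => mul_nonneg (inv_nonneg.2 (multichoose_pos ha' k).le) (sq_nonneg _))]
    rw [← tendsto_add_atTop_iff_nat 1]
    have ih' := ih.tendsto_sum_nat.comp (tendsto_add_atTop_nat 1)
    -- Here `1 ≤ a` enters: bounded weights let coefficient decay alone kill the boundary term.
    have hinv (k : ℕ) : |(Ring.multichoose a k)⁻¹| ≤ 1 := by
      rw [abs_of_pos (inv_pos.2 (multichoose_pos ha' k))]
      refine inv_le_one_of_one_le₀ ?_
      induction k with
      | zero => simp
      | succ k ihk =>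
        have h := succ_mul_multichoose_succ' a k
        have : ((k : ℝ) + 1) * 1 ≤ (a + k) * Ring.multichoose a k :=
          mul_le_mul (by linarith) ihk zero_le_one (by positivity)
        rw [← h] at this
        exact le_of_mul_le_mul_left this (by positivity)
    obtain ⟨e0, e1⟩ := tendsto_coeff_mobiusMonomial hc a m
    obtain ⟨f0, f1⟩ := tendsto_coeff_mobiusMonomial hc a (m + 1)
    have hB : Tendsto (fun K : ℕ => ((K : ℝ) + 1) * (Ring.multichoose a K)⁻¹ *
        (c ^ 2 * coeff (K + 1) e * coeff K f - coeff K e * coeff (K + 1) f)) atTop (𝓝 0) := by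
      have e1' := e1.comp (tendsto_add_atTop_nat 1)
      have f1' := f1.comp (tendsto_add_atTop_nat 1)
      have := (((e1'.mul f0).const_mul (c ^ 2)).sub (f1'.mul e0)).norm
      simp only [mul_zero, sub_zero, norm_zero] at this
      refine squeeze_zero_norm (fun K => ?_) this
      simp only [Function.comp_apply]
      refine le_trans (le_of_eq ?_) (mul_le_of_le_one_left (norm_nonneg _) (hinv K))
      rw [← Real.norm_eq_abs, ← norm_mul]
      congr 1
      push_cast
      ring
    have hm1 : (0 : ℝ) < a + m := by positivity
    have hc' : 0 < 1 - c ^ 2 := by linarith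
    have key (K : ℕ) : ∑ k ∈ Finset.range (K + 1), (Ring.multichoose a k)⁻¹ * coeff k f ^ 2 =
        ((m + 1) * ∑ k ∈ Finset.range (K + 1), (Ring.multichoose a k)⁻¹ * coeff k e ^ 2 +
          (1 - c ^ 2)⁻¹ * (((K : ℝ) + 1) * (Ring.multichoose a K)⁻¹ *
        (c ^ 2 * coeff (K + 1) e * coeff K f - coeff K e * coeff (K + 1) f))) / (a + m) := by
      rw [← sum_raiseOp_sub_lowerOp ha' c e f K, he, raiseOp_mobiusMonomial, hf,
        lowerOp_mobiusMonomial, eq_div_iff hm1.ne', Finset.mul_sum, Finset.mul_sum,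
        Finset.sum_mul, ← Finset.sum_add_distrib]
      refine Finset.sum_congr rfl fun k _ => ?_
      rw [coeff_C_mul, coeff_C_mul]
      field_simp
      ring
    have hlim := ((ih'.const_mul ((m : ℝ) + 1)).add (hB.const_mul (1 - c ^ 2)⁻¹)).div_const (a + m)
    have hval : (((m : ℝ) + 1) * ((Ring.multichoose a m)⁻¹ * (1 - c ^ 2) ^ (-a)) +
        (1 - c ^ 2)⁻¹ * 0) / (a + m) = (Ring.multichoose a (m + 1))⁻¹ * (1 - c ^ 2) ^ (-a) := by
      have h := succ_mul_multichoose_succ' a m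
      have h1 := (multichoose_pos ha' m).ne'
      have h2 := (multichoose_pos ha' (m + 1)).ne'
      rw [mul_zero, add_zero, ← mul_assoc, mul_div_right_comm]
      congr 1
      field_simp
      linear_combination h
    rw [hval] at hlim
    exact hlim.congr fun K => (key K).symm

end LadderOperators

/-! ### Jacobi polynomials as Taylor coefficients. -/

section JacobiFunctions

open PowerSeries

/-- Since `k + α = m`, the defining sum is the Cauchy product for `(1 - rX)^(k + β) (1 + (1 -
r)X)^m`. -/
theorem jacobiP_eq_coeff (k m : ℕ) (β r : ℝ) :
    jacobiP k ((m : ℝ) - k) β (1 - 2 * r) =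
      coeff k (mk (fun s => Ring.choose ((k : ℝ) + β) s * (-r) ^ s) *
        mk (fun j => (m.choose j : ℝ) * (1 - r) ^ j)) := by
  rw [coeff_mul, Finset.Nat.sum_antidiagonal_eq_sum_range_succ_mk, jacobiP]
  refine Finset.sum_congr rfl fun s _ => ?_
  rw [add_sub_cancel, Ring.choose_natCast, coeff_mk, coeff_mk]
  ring_nf

theorem mk_choose_succ (m : ℕ) (t : ℝ) :
    (mk fun j => ((m + 1).choose j : ℝ) * t ^ j) =
      (1 + C t * X) * mk fun j => (m.choose j : ℝ) * t ^ j := by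
  rw [add_mul, one_mul, mul_assoc]
  ext k
  cases k with
  | zero => simp
  | succ k =>
    rw [map_add, coeff_C_mul, coeff_succ_X_mul]
    simp only [coeff_mk, Nat.choose_succ_succ]
    push_cast
    ring

theorem jacobiP_succ (k m : ℕ) (β r : ℝ) :
    jacobiP (k + 1) (((m + 1 : ℕ) : ℝ) - (k + 1 : ℕ)) β (1 - 2 * r) =
      jacobiP (k + 1) ((m : ℝ) - (k + 1 : ℕ)) β (1 - 2 * r) +
        (1 - r) * jacobiP k ((m : ℝ) - k) (β + 1) (1 - 2 * r) := by
  rw [jacobiP_eq_coeff, jacobiP_eq_coeff, jacobiP_eq_coeff, mk_choose_succ,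
    show ((k + 1 : ℕ) : ℝ) + β = k + (β + 1) by push_cast; ring, ← coeff_C_mul,
    ← coeff_succ_X_mul k (C (1 - r) * _), ← map_add]
  congr 1
  ring

theorem jacobiP_zero (α β x : ℝ) : jacobiP 0 α β x = 1 := by
  simp [jacobiP]

/-- The Jacobi polynomials `P_k^{(m - k, β)}` are, up to sign and powers of `c`, the Taylor
coefficients of `(w - c) ^ m (1 - c w) ^ (-(β + 1 + m))`. -/
theorem jacobiP_eq_coeff_mobiusMonomial (c β : ℝ) (k m : ℕ) :
    (-c) ^ m * jacobiP k ((m : ℝ) - k) β (1 - 2 * c ^ 2) =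
      (-c) ^ k * coeff k (mobiusMonomial c (β + 1) m) := by
  induction m generalizing k β with
  | zero =>
    have h1 : (mk fun j => (Nat.choose 0 j : ℝ) * (1 - c ^ 2) ^ j) = 1 := by
      ext j
      cases j <;> simp [coeff_one]
    rw [jacobiP_eq_coeff, h1]
    simp only [mobiusMonomial, negBinomialSeries, pow_zero, one_mul, mul_one, coeff_mk,
      Nat.cast_zero, add_zero, Ring.multichoose_eq]
    rw [show β + 1 + k - 1 = (k : ℝ) + β by ring, neg_pow (c ^ 2), neg_pow c]
    ring
  | succ m ih =>
    cases k with
    | zero => simp [jacobiP_zero, mobiusMonomial, negBinomialSeries]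
    | succ k =>
      -- Splitting `X - c = (1 - c²)X - c(1 - cX)` reproduces the recursion `jacobiP_succ`.
      have h : mobiusMonomial c (β + 1) (m + 1) = C (1 - c ^ 2) *
          (X * mobiusMonomial c (β + 1 + 1) m) - C c * mobiusMonomial c (β + 1) m := by
        have := one_sub_mul_negBinomialSeries c (β + 1 + m)
        simp only [mobiusMonomial, Nat.cast_add, Nat.cast_one,
          show β + 1 + 1 + m = β + 1 + m + 1 by ring, ← add_assoc, ← this]
        simp only [map_sub, map_one, map_pow]
        ring
      rw [h, jacobiP_succ, map_sub, coeff_C_mul, coeff_C_mul, coeff_succ_X_mul]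
      linear_combination (-c) * ih β (k + 1) + (-c) * (1 - c ^ 2) * ih (β + 1) k

theorem jacobiP_self_zero (m : ℕ) (β : ℝ) : jacobiP m ((m : ℝ) - m) β 1 = 1 := by
  have := jacobiP_eq_coeff m m β 0
  rw [mul_zero, sub_zero] at this
  rw [this, coeff_mul, Finset.sum_eq_single (0, m)]
  · simp
  · rintro ⟨i, j⟩ hij hne
    have : i ≠ 0 := by
      rintro rfl
      simp_all
    simp [this]
  · simp

theorem norm_basisPhi_sq {σ : ℝ} {m : ℕ} (hm : (m : ℝ) < (σ - 1) / 2) {z : ℂ} (hz : ‖z‖ < 1)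
    (k : ℕ) :
    ‖basisPhi σ m k z‖ ^ 2 =
      (σ - 2 * m - 1) / Real.pi * (1 - ‖z‖ ^ 2) ^ (-(2 * m : ℝ)) * Ring.multichoose (σ - 2 * m) m *
        ((Ring.multichoose (σ - 2 * m) k)⁻¹ * coeff k (mobiusMonomial ‖z‖ (σ - 2 * m) m) ^ 2) := by
  set a := σ - 2 * m with ha
  have ha1 : 1 < a := by linarith
  have ha0 : 0 < a := by linarith
  have hr : 0 < 1 - ‖z‖ ^ 2 := by nlinarith [norm_nonneg z]
  have hG := Real.Gamma_pos_of_pos ha0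
  have hmk := multichoose_pos ha0 k
  have hmm := multichoose_pos ha0 m
  have hJ : (‖z‖ ^ ((m : ℤ) - k)) ^ 2 * jacobiP k ((m : ℝ) - k) (a - 1) (1 - 2 * ‖z‖ ^ 2) ^ 2 =
      coeff k (mobiusMonomial ‖z‖ a m) ^ 2 := by
    rcases eq_or_ne ‖z‖ 0 with h0 | h0
    -- At `z = 0` the general identity loses its content through the powers of `c`; instead the
    -- series is `X^m`, and only `k = m` survives.
    · rw [h0]
      have hc : mobiusMonomial 0 a m = X ^ m := by
        have : negBinomialSeries 0 (a + m) = 1 := by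
          ext j
          cases j <;> simp [negBinomialSeries, coeff_one]
        simp [mobiusMonomial, this]
      rw [hc, coeff_X_pow]
      split_ifs with hk
      · subst hk
        have := jacobiP_self_zero k (a - 1)
        simp_all
      · rw [zero_zpow _ (by omega)]
        simp
    · have h := jacobiP_eq_coeff_mobiusMonomial ‖z‖ (a - 1) k m
      rw [sub_add_cancel] at h
      have h' := congrArg (· ^ 2) h
      simp only [mul_pow, ← pow_mul, mul_comm _ 2] at h'
      simp only [pow_mul, neg_sq] at h'
      rw [zpow_sub₀ h0, zpow_natCast, zpow_natCast, div_pow, div_mul_eq_mul_div,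
        div_eq_iff (by positivity)]
      rw [← pow_mul, ← pow_mul, mul_comm 2 m, mul_comm 2 k, pow_mul, pow_mul] at h'
      linarith
  have hden : ‖(1 : ℂ) - z * starRingEnd ℂ z‖ = 1 - ‖z‖ ^ 2 := by
    rw [Complex.mul_conj, Complex.normSq_eq_norm_sq, ← Complex.ofReal_one, ← Complex.ofReal_sub,
      Complex.norm_real, Real.norm_of_nonneg hr.le]
  rw [← hJ, basisPhi]
  simp only [norm_mul, norm_div, norm_pow, norm_zpow, norm_neg, norm_one, one_pow, one_mul,
    RCLike.norm_conj, hden, Complex.norm_real, Real.norm_eq_abs, mul_pow, div_pow, sq_abs]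
  rw [Real.sq_sqrt]
  · rw [show σ - m = a + m by rw [ha]; ring, ← ha, Gamma_add_nat ha0, Gamma_add_nat ha0,
      Real.rpow_neg hr.le, show (2 * m : ℝ) = ((m * 2 : ℕ) : ℝ) by push_cast; ring,
      Real.rpow_natCast, pow_mul]
    field_simp
  · rw [show σ - m = a + m by rw [ha]; ring, ← ha, Gamma_add_nat ha0, Gamma_add_nat ha0]
    have : 0 < a - 1 := by linarith
    positivity

theorem hasSum_norm_basisPhi_sq {σ : ℝ} {m : ℕ} (hm : (m : ℝ) < (σ - 1) / 2) {z : ℂ}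
    (hz : ‖z‖ < 1) :
    HasSum (fun k : ℕ => ‖basisPhi σ m k z‖ ^ 2)
      ((σ - 2 * m - 1) / (Real.pi * (1 - ‖z‖ ^ 2) ^ σ)) := by
  have hr : 0 < 1 - ‖z‖ ^ 2 := by nlinarith [norm_nonneg z]
  have h := (hasSum_sq_coeff_mobiusMonomial (a := σ - 2 * m) (by linarith) (c := ‖z‖)
    (by rwa [abs_norm]) m).mul_left ((σ - 2 * m - 1) / Real.pi *
      (1 - ‖z‖ ^ 2) ^ (-(2 * m : ℝ)) * Ring.multichoose (σ - 2 * m) m)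
  simp only [← norm_basisPhi_sq hm hz] at h
  have hmm := (multichoose_pos (a := σ - 2 * m) (by linarith) m).ne'
  have hσ : (1 - ‖z‖ ^ 2) ^ (-(2 * m : ℝ)) * (1 - ‖z‖ ^ 2) ^ (-(σ - 2 * m)) =
      ((1 - ‖z‖ ^ 2) ^ σ)⁻¹ := by
    rw [← Real.rpow_add hr, ← Real.rpow_neg hr.le]
    ring_nf
  have hval : (σ - 2 * m - 1) / (Real.pi * (1 - ‖z‖ ^ 2) ^ σ) =
      (σ - 2 * m - 1) / Real.pi * (1 - ‖z‖ ^ 2) ^ (-(2 * m : ℝ)) *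
        Ring.multichoose (σ - 2 * m) m *
        ((Ring.multichoose (σ - 2 * m) m)⁻¹ * (1 - ‖z‖ ^ 2) ^ (-(σ - 2 * m))) := by
    rw [← div_div, div_eq_mul_inv _ ((1 - ‖z‖ ^ 2) ^ σ), ← hσ]
    field_simp
  rwa [hval]

end JacobiFunctions

/-! ### Orthonormal expansions and the normalization factor. -/

theorem Orthonormal.summable_smul_iff {ι H : Type*} [NormedAddCommGroup H] [InnerProductSpace ℂ H]
    [CompleteSpace H] {ψ : ι → H} (hψ : Orthonormal ℂ ψ) (a : ι → ℂ) :
    Summable (fun k => a k • ψ k) ↔ Summable (fun k => ‖a k‖ ^ 2) := by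
  simpa using hψ.orthogonalFamily.summable_iff_norm_sq_summable a

theorem Orthonormal.hasSum_norm_sq {ι H : Type*} [NormedAddCommGroup H] [InnerProductSpace ℂ H]
    {ψ : ι → H} (hψ : Orthonormal ℂ ψ) {a : ι → ℂ} {v : H} (h : HasSum (fun k => a k • ψ k) v) :
    HasSum (fun k => ‖a k‖ ^ 2) (‖v‖ ^ 2) := by
  have h2 : Filter.Tendsto (fun s : Finset ι => ‖∑ k ∈ s, a k • ψ k‖ ^ 2) Filter.atTop
    (nhds (‖v‖ ^ 2)) := h.norm.pow 2
  refine h2.congr fun s => ?_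
  simpa using hψ.orthogonalFamily.norm_sum a s

theorem corollary3p1 {H : Type*} [NormedAddCommGroup H] [InnerProductSpace ℂ H] [CompleteSpace H]
    (ψ : ℕ → H) (hψ : Orthonormal ℂ ψ)
    (σ : ℝ) (hσ : 1 < σ) (m : ℕ) (hm : (m : ℝ) < (σ - 1) / 2)
    (z : ℂ) (hz : ‖z‖ < 1) :
    HasSum (fun k : ℕ => ‖basisPhi σ m k z‖ ^ 2)
        ((σ - 2 * m - 1) / (Real.pi * (1 - ‖z‖ ^ 2) ^ σ)) ∧
      ∀ N : ℝ, IsNormalizationFactor ψ σ m z N ↔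
        N = (σ - 2 * m - 1) / (Real.pi * (1 - ‖z‖ ^ 2) ^ σ) := by
  have hsum := hasSum_norm_basisPhi_sq hm hz
  refine ⟨hsum, fun N => ?_⟩
  have hr : 0 < 1 - ‖z‖ ^ 2 := by nlinarith [norm_nonneg z]
  set S := (σ - 2 * m - 1) / (Real.pi * (1 - ‖z‖ ^ 2) ^ σ) with hS
  have hS0 : 0 < S := by
    have : 0 < σ - 2 * m - 1 := by linarith
    positivity
  have hconv : Summable (fun k : ℕ => starRingEnd ℂ (basisPhi σ m k z) • ψ k) := by
    rw [hψ.summable_smul_iff]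
    simpa using hsum.summable
  have hnorm : ‖∑' k : ℕ, starRingEnd ℂ (basisPhi σ m k z) • ψ k‖ ^ 2 = S := by
    have := hψ.hasSum_norm_sq hconv.hasSum
    simp only [RCLike.norm_conj] at this
    exact this.unique hsum
  -- The state has squared norm `S / N`, which is `1` exactly when `N = S`.
  have hinner (hN : 0 < N) :
      inner ℂ (coherentState ψ σ m N z) (coherentState ψ σ m N z) = ((N⁻¹ * S : ℝ) : ℂ) := by
    rw [inner_self_eq_norm_sq_to_K, coherentState, norm_smul, Complex.norm_real,
      Real.norm_of_nonneg (by positivity)]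
    norm_cast
    rw [mul_pow, hnorm, ← Real.rpow_natCast, ← Real.rpow_mul hN.le]
    norm_num [Real.rpow_neg_one]
  constructor
  · rintro ⟨hN, -, h1⟩
    rw [hinner hN] at h1
    have h2 : N⁻¹ * S = 1 := by exact_mod_cast h1
    field_simp at h2
    exact h2.symm
  · rintro rfl
    refine ⟨hS0, hconv, ?_⟩
    rw [hinner hS0, inv_mul_cancel₀ hS0.ne', Complex.ofReal_one]
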